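/- Let $G$ be a locally compact (Hausdorff) abelian group, $\mathcal A$ a C*-algebra and $\alpha$ an action of $G$ on $\mathcal A$ by *-automorphisms; no continuity of $\alpha$ is assumed. Let $\mathcal L=C^*(G)$ be the group C*-algebra and $\eta:G\to UM(\mathcal L)$ the canonical homomorphism into the unitaries of its multiplier algebra. A homomorphism $\psi:\mathcal D\to M(\mathcal E)$ from a C*-algebra to the multiplier algebra of a C*-algebra is called *non-degenerate* if there is an approximate identity $(u_\lambda)$ of $\mathcal D$ with $\psi(u_\lambda)\to 1$ strictly in $M(\mathcal E)$; then $\widetilde\psi:M(\mathcal D)\to M(\mathcal E)$ denotes its unique extension to a unital *-homomorphism. For a non-degenerate representation $\pi:\mathcal D\to B(\mathcal H)$, likewise, $\widetilde\pi:M(\mathcal D)\to B(\mathcal H)$ denotes its unique unital extension. Suppose that $(\mathcal A,G,\alpha)$ has a full crossed product host $\mathrm{fcph}(\mathcal A,G,\alpha)=(\mathcal B,\eta_{\mathcal A},\eta_{\mathcal L})$ for $(\alpha,C^*(G))$, that is, a C*-algebra $\mathcal B$ with *-homomorphisms $\eta_{\mathcal A}:\mathcal A\to M(\mathcal B)$ and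 $\eta_{\mathcal L}:\mathcal L\to M(\mathcal B)$ such that 1. $\eta_{\mathcal L}$ is non-degenerate; 2. $\widetilde\eta_{\mathcal L}(\eta(g))\,\eta_{\mathcal A}(A)\,\widetilde\eta_{\mathcal L}(\eta(g))^*=\eta_{\mathcal A}(\alpha_g(A))$ for all $A\in\mathcal A$, $g\in G$; 3. $\eta_{\mathcal A}(\mathcal A)\eta_{\mathcal L}(\mathcal L)\subseteq\mathcal B$, and $\mathcal B$ is generated by this set as a C*-algebra; 4. for every covariant representation $(\pi,U)$ of $(\mathcal A,G,\alpha)$ on a Hilbert space $\mathcal H$ ($\pi$ a non-degenerate representation of $\mathcal A$, $U$ a strongly continuous unitary representation of $G$, and $U(g)\pi(A)U(g)^*=\pi(\alpha_g(A))$), with $U_{\mathcal L}$ the non-degenerate representation of $\mathcal L$ such that $\widetilde{U_{\mathcal L}}\circ\eta=U$, there is a unique representation $\rho:\mathcal B\to B(\mathcal H)$ with $\rho(\eta_{\mathcal A}(A)\eta_{\mathcal L}(L))=\pi(A)U_{\mathcal L}(L)$ for all $A\in\mathcal A$, $L\in\mathcal L$. Let $\mathcal C$ be a C*-algebra, $\phi:\mathcal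 A\to M(\mathcal C)$ a non-degenerate homomorphism, and $U:G\to UM(\mathcal C)$ a strictly continuous homomorphism into the unitaries of $M(\mathcal C)$ such that $$\phi(\alpha_s(A))=U(s)\phi(A)U(s)^*\qquad\text{for all }A\in\mathcal A,\ s\in G.$$ Then there is a non-degenerate homomorphism $\rho:\mathrm{fcph}(\mathcal A,G,\alpha)=\mathcal B\to M(\mathcal C)$ such that $$\widetilde\rho\circ\eta_{\mathcal A}=\phi\qquad\text{and}\qquad \widetilde\rho\circ\widetilde\eta_{\mathcal L}\circ\eta=U.$$ -/

import Mathlib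

open Filter Topology MeasureTheory
open scoped MultiplierAlgebra CompactlySupported ENNReal

universe u v w

noncomputable section

namespace CPHost

/-! ### Non-degenerate homomorphisms and their extensions to multiplier algebras -/

section Multiplier

variable {A B : Type*} [NonUnitalCStarAlgebra A] [NonUnitalCStarAlgebra B]

/-- A homomorphism `φ : A → M(B)` is non-degenerate if there is an approximate identity
`(u_λ)` of `A` (encoded as a filter on `A` which is eventually in the unit ball) such that
`φ(u_λ) → 1` strictly in `M(B)`, that is, `φ(u_λ) b → b` and `b φ(u_λ) → b` for all `b` in `B`. -/
def IsNonDegenerate (φ : A →⋆ₙₐ[ℂ] 𝓜(ℂ, B)) : Prop :=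
  ∃ l : Filter A, l.IsApproximateUnit ∧ (∀ᶠ a in l, ‖a‖ ≤ 1) ∧
    (∀ b : B, Tendsto (fun a => (φ a).fst b) l (𝓝 b)) ∧
    (∀ b : B, Tendsto (fun a => (φ a).snd b) l (𝓝 b))

/-- A map into `M(B)` is strictly continuous if `x ↦ f(x) b` and `x ↦ b f(x)` are norm continuous
for every `b` in `B`. -/
def StrictlyContinuous {X : Type*} [TopologicalSpace X] (f : X → 𝓜(ℂ, B)) : Prop :=
  ∀ b : B, Continuous (fun x => (f x).fst b) ∧ Continuous (fun x => (f x).snd b)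

/-- A representation of `A` by bounded operators on `H` is non-degenerate if `π(A)H` spans a dense
subspace of `H`. -/
def IsNonDegenerateRep {H : Type*} [NormedAddCommGroup H] [InnerProductSpace ℂ H] [CompleteSpace H]
    (π : A →⋆ₙₐ[ℂ] (H →L[ℂ] H)) : Prop :=
  Dense (Submodule.span ℂ {y : H | ∃ (a : A) (x : H), π a x = y} : Set H)

theorem fst_mul (m : 𝓜(ℂ, A)) (a b : A) : m.fst (a * b) = m.fst a * b := by
  have h : ∀ z : A, z * (m.fst (a * b) - m.fst a * b) = 0 := fun z => by
    rw [mul_sub, ← m.central, ← mul_assoc, ← mul_assoc, m.central, sub_self]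
  exact sub_eq_zero.1 (CStarRing.star_mul_self_eq_zero_iff _ |>.1 (h _))

theorem star_fst_mul (m : 𝓜(ℂ, A)) (a b : A) :
    star (m.fst a) * b = star a * (star m).fst b := by
  have h := congrArg star (m.central (star b) a)
  simpa using h.symm

theorem ext_fst {m n : 𝓜(ℂ, A)} (h : m.fst = n.fst) : m = n := by
  refine sub_eq_zero.1 (norm_eq_zero.1 ?_)
  rw [← DoubleCentralizer.norm_fst, DoubleCentralizer.sub_fst, h, sub_self, norm_zero]

theorem mul_coe (m : 𝓜(ℂ, A)) (a : A) : m * (a : 𝓜(ℂ, A)) = (m.fst a : A) := by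
  refine ext_fst (ContinuousLinearMap.ext fun b => ?_)
  simp [fst_mul]

theorem exists_approximateUnit (A : Type*) [NonUnitalCStarAlgebra A] :
    ∃ l : Filter A, l.IsApproximateUnit ∧ ∀ᶠ a in l, ‖a‖ ≤ 1 := by
  let _ := CStarAlgebra.spectralOrder A
  let _ := CStarAlgebra.spectralOrderedRing A
  have h := CStarAlgebra.increasingApproximateUnit A
  exact ⟨_, h.toIsApproximateUnit, h.eventually_norm⟩

theorem exists_extension {X : Type*} [NormedAddCommGroup X] [NormedSpace ℂ X] [CompleteSpace X]
    (p : A → X →L[ℂ] X) (hmul : ∀ a b, p (a * b) = p a * p b) (hle : ∀ a, ‖p a‖ ≤ ‖a‖)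
    (hcont : Continuous p)
    (hd : Dense (Submodule.span ℂ {y : X | ∃ (a : A) (x : X), p a x = y} : Set X))
    (m : 𝓜(ℂ, A)) : ∃ T : X →L[ℂ] X, ∀ a x, T (p a x) = p (m.fst a) x := by
  obtain ⟨l, hl, hl1⟩ := exists_approximateUnit A
  have := hl.neBot
  let e : (A × X →₀ ℂ) →ₗ[ℂ] X := Finsupp.linearCombination ℂ fun q => p q.1 q.2
  let f : (A × X →₀ ℂ) →ₗ[ℂ] X := Finsupp.linearCombination ℂ fun q => p (m.fst q.1) q.2
  have he : DenseRange e := by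
    have h : Set.range (fun q : A × X => p q.1 q.2) = {y : X | ∃ (a : A) (x : X), p a x = y} := by
      ext y
      simp
    have h2 := Finsupp.range_linearCombination ℂ (v := fun q : A × X => p q.1 q.2)
    rw [h] at h2
    rw [← h2] at hd
    exact hd
  have ht : ∀ z, Tendsto (fun a => p (m.fst a) (e z)) l (𝓝 (f z)) := by
    intro z
    induction z using Finsupp.induction_linear with
    | zero => simp
    | add z w hz hw => simpa using hz.add hw
    | single q c =>
      have h1 : Tendsto (fun a => p (m.fst (a * q.1)) q.2) l (𝓝 (p (m.fst q.1) q.2)) := by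
        have hc : Continuous fun a => p (m.fst a) q.2 :=
          (hcont.comp m.fst.continuous).clm_apply continuous_const
        exact (hc.tendsto q.1).comp (hl.tendsto_mul_right q.1)
      have h2 := h1.const_smul c
      simpa [e, f, Finsupp.linearCombination_single, fst_mul, hmul] using h2
  have hb : ∀ z, ‖f z‖ ≤ ‖m.fst‖ * ‖e z‖ := by
    intro z
    refine le_of_tendsto (ht z).norm ?_
    filter_upwards [hl1] with a ha
    calc ‖p (m.fst a) (e z)‖ ≤ ‖p (m.fst a)‖ * ‖e z‖ := (p _).le_opNorm _
      _ ≤ ‖m.fst‖ * ‖e z‖ := by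
        gcongr
        calc ‖p (m.fst a)‖ ≤ ‖m.fst a‖ := hle _
          _ ≤ ‖m.fst‖ * ‖a‖ := m.fst.le_opNorm _
          _ ≤ ‖m.fst‖ := mul_le_of_le_one_right (norm_nonneg _) ha
  refine ⟨f.extendOfNorm e, fun a x => ?_⟩
  have h := LinearMap.extendOfNorm_eq he ⟨_, hb⟩ (Finsupp.single (a, x) 1)
  simpa [e, f, Finsupp.linearCombination_single] using h

theorem continuous_hom {D : Type*} [NonUnitalCStarAlgebra D] (φ : A →⋆ₙₐ[ℂ] D) :
    Continuous φ :=
  AddMonoidHomClass.continuous_of_bound φ 1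
    (by simpa only [one_mul] using NonUnitalStarAlgHom.norm_apply_le φ)

theorem continuous_fst : Continuous (fun m : 𝓜(ℂ, B) => m.fst) := by
  have h : LipschitzWith 1 (fun m : 𝓜(ℂ, B) => m.fst) := by
    refine LipschitzWith.of_dist_le_mul fun m n => ?_
    rw [dist_eq_norm, dist_eq_norm, ← DoubleCentralizer.sub_fst, DoubleCentralizer.norm_fst]
    simp
  exact h.continuous

theorem IsNonDegenerate.dense {φ : A →⋆ₙₐ[ℂ] 𝓜(ℂ, B)} (hφ : IsNonDegenerate φ) :
    Dense (Submodule.span ℂ {y : B | ∃ (a : A) (x : B), (φ a).fst x = y} : Set B) := by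
  obtain ⟨l, hl, -, h, -⟩ := hφ
  have := hl.neBot
  intro b
  refine mem_closure_of_tendsto (h b) (Eventually.of_forall fun a => ?_)
  exact Submodule.subset_span ⟨a, b, rfl⟩

/-- The multiplier extension of a non-degenerate homomorphism exists and is unique. -/
theorem existsUnique_multiplierExtension (φ : A →⋆ₙₐ[ℂ] 𝓜(ℂ, B)) (hφ : IsNonDegenerate φ) :
    ∃! ψ : 𝓜(ℂ, A) →⋆ₐ[ℂ] 𝓜(ℂ, B), ∀ a : A, ψ (a : 𝓜(ℂ, A)) = φ a := by
  have hd := hφ.dense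
  have key : ∀ S T : B →L[ℂ] B,
      (∀ a x, S ((φ a).fst x) = T ((φ a).fst x)) → S = T := by
    intro S T h
    refine ContinuousLinearMap.ext_on hd ?_
    rintro _ ⟨a, x, rfl⟩
    exact h a x
  have hT : ∀ m : 𝓜(ℂ, A), ∃ T : B →L[ℂ] B, ∀ a x, T ((φ a).fst x) = (φ (m.fst a)).fst x := by
    intro m
    refine exists_extension (fun a => (φ a).fst) (fun a b => ?_) (fun a => ?_) ?_ hd m
    · rw [map_mul]; rfl
    · rw [DoubleCentralizer.norm_fst]; exact NonUnitalStarAlgHom.norm_apply_le φ a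
    · exact continuous_fst.comp (continuous_hom φ)
  choose T hT using hT
  have hcent : ∀ (m : 𝓜(ℂ, A)) (x y : B), star (T (star m) x) * y = star x * T m y := by
    intro m x y
    have h1 : (ContinuousLinearMap.mul ℂ B (star (T (star m) x))) =
        (ContinuousLinearMap.mul ℂ B (star x)).comp (T m) := by
      refine key _ _ fun a y => ?_
      simp only [ContinuousLinearMap.mul_apply', ContinuousLinearMap.comp_apply, hT]
      have h2 : (ContinuousLinearMap.mul ℂ B (star ((φ a).fst y))).comp (T (star m)) =
          ContinuousLinearMap.mul ℂ B (star ((φ (m.fst a)).fst y)) := by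
        refine key _ _ fun c z => ?_
        simp only [ContinuousLinearMap.mul_apply', ContinuousLinearMap.comp_apply, hT]
        rw [star_fst_mul, star_fst_mul, ← map_star, ← map_star]
        have e1 : ∀ p q : A, (φ p).fst ((φ q).fst z) = (φ (p * q)).fst z := fun p q => by
          rw [map_mul]; rfl
        rw [e1, e1, star_fst_mul]
      have h3 := congrArg star (DFunLike.congr_fun h2 x)
      simpa using h3
    exact DFunLike.congr_fun h1 y
  let S : 𝓜(ℂ, A) → 𝓜(ℂ, B) := fun m =>
    { fst := T m
      snd := (((starₗᵢ ℂ : B ≃ₗᵢ⋆[ℂ] B) : B →L⋆[ℂ] B).comp (T (star m))).comp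
          ((starₗᵢ ℂ : B ≃ₗᵢ⋆[ℂ] B) : B →L⋆[ℂ] B)
      central := fun x y => by
        simpa using hcent m (star x) y }
  have hS : ∀ m a x, (S m).fst ((φ a).fst x) = (φ (m.fst a)).fst x := hT
  refine ⟨{ toFun := S
            map_one' := ext_fst (key _ _ fun a x => ?_)
            map_mul' := fun m n => ext_fst (key _ _ fun a x => ?_)
            map_zero' := ext_fst (key _ _ fun a x => ?_)
            map_add' := fun m n => ext_fst (key _ _ fun a x => ?_)
            commutes' := fun c => ext_fst (key _ _ fun a x => ?_)
            map_star' := fun m => ext_fst ?_ }, fun a => ext_fst (key _ _ fun c x => ?_),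
          fun ψ hψ => ?_⟩
  · rw [hS]; rfl
  · rw [hS, DoubleCentralizer.mul_fst, DoubleCentralizer.mul_fst]
    change _ = (S m).fst ((S n).fst _)
    rw [hS, hS]
    rfl
  · rw [hS]; simp
  · rw [hS, DoubleCentralizer.add_fst, DoubleCentralizer.add_fst]
    simp [hS]
  · rw [hS, DoubleCentralizer.algebraMap_fst, DoubleCentralizer.algebraMap_fst]
    simp [Algebra.algebraMap_eq_smul_one]
  · ext x
    rw [DoubleCentralizer.star_fst]
    change T (star m) x = star (star (T (star m) (star (star x))))
    simp
  · change (S a).fst _ = _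
    rw [hS]
    simp
  · refine StarAlgHom.ext fun m => ext_fst (key _ _ fun a x => ?_)
    change _ = (S m).fst _
    rw [hS, ← hψ, ← hψ, ← mul_coe, map_mul]
    rfl

/-- The unique extension `φ̃ : M(A) → M(B)` of a non-degenerate homomorphism `φ : A → M(B)`;
it is determined by `φ̃(m) φ(a) b = φ(m a) b`. -/
def multiplierExtension (φ : A →⋆ₙₐ[ℂ] 𝓜(ℂ, B)) (hφ : IsNonDegenerate φ) :
    𝓜(ℂ, A) →⋆ₐ[ℂ] 𝓜(ℂ, B) :=
  (existsUnique_multiplierExtension φ hφ).choose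

theorem multiplierExtension_coe (φ : A →⋆ₙₐ[ℂ] 𝓜(ℂ, B)) (hφ : IsNonDegenerate φ) (a : A) :
    multiplierExtension φ hφ (a : 𝓜(ℂ, A)) = φ a :=
  (existsUnique_multiplierExtension φ hφ).choose_spec.1 a

variable {H : Type*} [NormedAddCommGroup H] [InnerProductSpace ℂ H] [CompleteSpace H]

/-- The extension of a non-degenerate representation to the multiplier algebra exists and is
unique. -/
theorem existsUnique_repExtension (π : A →⋆ₙₐ[ℂ] (H →L[ℂ] H)) (hπ : IsNonDegenerateRep π) :
    ∃! ψ : 𝓜(ℂ, A) →⋆ₐ[ℂ] (H →L[ℂ] H), ∀ a : A, ψ (a : 𝓜(ℂ, A)) = π a := by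
  have key : ∀ S T : H →L[ℂ] H, (∀ a x, S (π a x) = T (π a x)) → S = T := by
    intro S T h
    refine ContinuousLinearMap.ext_on hπ ?_
    rintro _ ⟨a, x, rfl⟩
    exact h a x
  have hT : ∀ m : 𝓜(ℂ, A), ∃ T : H →L[ℂ] H, ∀ a x, T (π a x) = π (m.fst a) x := fun m =>
    exists_extension (fun a => π a) (fun a b => map_mul π a b)
      (fun a => NonUnitalStarAlgHom.norm_apply_le π a) (continuous_hom π) hπ m
  choose T hT using hT
  refine ⟨{ toFun := T
            map_one' := key _ _ fun a x => ?_
            map_mul' := fun m n => key _ _ fun a x => ?_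
            map_zero' := key _ _ fun a x => ?_
            map_add' := fun m n => key _ _ fun a x => ?_
            commutes' := fun c => key _ _ fun a x => ?_
            map_star' := fun m => key _ _ fun a x => ?_ }, fun a => key _ _ fun c x => ?_,
          fun ψ hψ => ?_⟩
  · rw [hT]; rfl
  · rw [hT, DoubleCentralizer.mul_fst]
    change _ = T m (T n _)
    rw [hT, hT]
    rfl
  · rw [hT]; simp
  · rw [hT, DoubleCentralizer.add_fst]
    simp [hT]
  · rw [hT, DoubleCentralizer.algebraMap_fst]
    simp [Algebra.algebraMap_eq_smul_one]
  · rw [ContinuousLinearMap.star_eq_adjoint]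
    refine ext_inner_left ℂ fun y => ?_
    rw [ContinuousLinearMap.adjoint_inner_right]
    have h : innerSL ℂ (T (star m) (π a x)) = (innerSL ℂ (π a x)).comp (T m) := by
      refine ContinuousLinearMap.ext_on hπ ?_
      rintro _ ⟨b, z, rfl⟩
      have e : ∀ (p q : A) (w : H), π p (π q w) = π (p * q) w := fun p q w => by
        rw [map_mul]; rfl
      simp only [innerSL_apply_apply, ContinuousLinearMap.comp_apply, hT]
      have e2 : ∀ (p : A) (w v : H), inner ℂ (π p w) v = inner ℂ w (π (star p) v) :=
        fun p w v => by
          rw [map_star, ContinuousLinearMap.star_eq_adjoint,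
            ContinuousLinearMap.adjoint_inner_right]
      rw [e2, e2, e, e, star_fst_mul, star_star]
    have h2 := congrArg (starRingEnd ℂ) (DFunLike.congr_fun h y)
    simpa using h2
  · change T a _ = _
    rw [hT]
    simp
  · refine StarAlgHom.ext fun m => key _ _ fun a x => ?_
    change _ = T m _
    rw [hT, ← hψ, ← hψ, ← mul_coe, map_mul]
    rfl

/-- The unique extension `π̃ : M(A) → B(H)` of a non-degenerate representation `π : A → B(H)`;
it is determined by `π̃(m) π(a) x = π(m a) x`. -/
def repExtension (π : A →⋆ₙₐ[ℂ] (H →L[ℂ] H)) (hπ : IsNonDegenerateRep π) :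
    𝓜(ℂ, A) →⋆ₐ[ℂ] (H →L[ℂ] H) :=
  (existsUnique_repExtension π hπ).choose

theorem repExtension_coe (π : A →⋆ₙₐ[ℂ] (H →L[ℂ] H)) (hπ : IsNonDegenerateRep π) (a : A) :
    repExtension π hπ (a : 𝓜(ℂ, A)) = π a :=
  (existsUnique_repExtension π hπ).choose_spec.1 a

end Multiplier

/-! ### The group C*-algebra -/

section GroupAlgebra

/-- A strongly continuous unitary representation of `G` on `H`. -/
structure UnitaryRep (G : Type*) [Group G] [TopologicalSpace G] (H : Type*)
    [NormedAddCommGroup H] [InnerProductSpace ℂ H] [CompleteSpace H] where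
  /-- The underlying homomorphism into the unitary group of `B(H)`. -/
  toHom : G →* unitary (H →L[ℂ] H)
  /-- Strong continuity. -/
  continuous_apply : ∀ x : H, Continuous fun g => (toHom g : H →L[ℂ] H) x

/-- A complex Hilbert space together with a strongly continuous unitary representation of `G`
on it. -/
structure HilbertRep (G : Type u) [Group G] [TopologicalSpace G] : Type (u + 1) where
  /-- The Hilbert space. -/
  space : Type u
  [normed : NormedAddCommGroup space]
  [inner : InnerProductSpace ℂ space]
  [complete : CompleteSpace space]
  /-- The representation. -/
  rep : UnitaryRep G space

attribute [instance] HilbertRep.normed HilbertRep.inner HilbertRep.complete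

theorem UnitaryRep.norm_apply {G : Type*} [Group G] [TopologicalSpace G] {H : Type*}
    [NormedAddCommGroup H] [InnerProductSpace ℂ H] [CompleteSpace H] (U : UnitaryRep G H)
    (g : G) (x : H) : ‖(U.toHom g : H →L[ℂ] H) x‖ = ‖x‖ :=
  ContinuousLinearMap.norm_map_of_mem_unitary (U.toHom g).2 x

/-- The C*-algebra of bounded families `(T_i)` with `T_i` in `B(H_i)`, indexed by all strongly
continuous unitary representations `(H_i, U_i)` of `G`. Every cyclic representation of `G` is
unitarily equivalent to one of these, because its Hilbert space has dimension at most
`max(|G|, ℵ₀)`. -/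
def UniversalAlgebra (G : Type u) [Group G] [TopologicalSpace G] : Type (u + 1) :=
  lp (fun i : HilbertRep G => i.space →L[ℂ] i.space) ∞

instance (G : Type u) [Group G] [TopologicalSpace G] :
    NonUnitalCStarAlgebra (UniversalAlgebra G) :=
  inferInstanceAs (NonUnitalCStarAlgebra (lp (fun i : HilbertRep G => i.space →L[ℂ] i.space) ∞))

/-- The image of `g` in `G` under the universal representation: the family `(U_i(g))`. -/
def universalUnitary {G : Type u} [Group G] [TopologicalSpace G] (g : G) : UniversalAlgebra G :=
  ⟨fun i => (i.rep.toHom g : i.space →L[ℂ] i.space), memℓp_infty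
    ⟨1, by
      rintro _ ⟨i, rfl⟩
      exact ContinuousLinearMap.opNorm_le_bound _ zero_le_one fun x => by
        rw [i.rep.norm_apply, one_mul]⟩⟩

theorem universalUnitary_one_mul {G : Type u} [Group G] [TopologicalSpace G]
    (x : UniversalAlgebra G) : universalUnitary (1 : G) * x = x := by
  refine lp.ext (funext fun i => ?_)
  change (i.rep.toHom 1 : i.space →L[ℂ] i.space) * x.1 i = x.1 i
  rw [map_one]
  exact one_mul _

theorem universalUnitary_mul {G : Type u} [Group G] [TopologicalSpace G] (g h : G) :
    universalUnitary (g * h) = universalUnitary g * universalUnitary h := by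
  refine lp.ext (funext fun i => ?_)
  change (i.rep.toHom (g * h) : i.space →L[ℂ] i.space) =
    (i.rep.toHom g : i.space →L[ℂ] i.space) * (i.rep.toHom h : i.space →L[ℂ] i.space)
  rw [map_mul]
  rfl

theorem star_universalUnitary {G : Type u} [Group G] [TopologicalSpace G] (g : G) :
    star (universalUnitary g) = universalUnitary g⁻¹ := by
  refine lp.ext (funext fun i => ?_)
  change star (i.rep.toHom g : i.space →L[ℂ] i.space) = (i.rep.toHom g⁻¹ : i.space →L[ℂ] i.space)
  rw [map_inv]
  rfl

variable {G : Type u} [Group G] [TopologicalSpace G] [IsTopologicalGroup G]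
  [LocallyCompactSpace G] [MeasurableSpace G] [BorelSpace G]

theorem UnitaryRep.integrable {H : Type*} [NormedAddCommGroup H] [InnerProductSpace ℂ H]
    [CompleteSpace H] (U : UnitaryRep G H) (f : C_c(G, ℂ)) (x : H) :
    Integrable (fun g => f g • (U.toHom g : H →L[ℂ] H) x) (Measure.haar : Measure G) :=
  (f.continuous.smul (U.continuous_apply x)).integrable_of_hasCompactSupport
    f.hasCompactSupport.smul_right

/-- The integrated operator `U(f) = ∫ f(s) U(s) ds` for `f` in `C_c(G)`; the integral is with
respect to left Haar measure and converges strongly. -/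
def UnitaryRep.integrated {H : Type*} [NormedAddCommGroup H] [InnerProductSpace ℂ H]
    [CompleteSpace H] (U : UnitaryRep G H) (f : C_c(G, ℂ)) : H →L[ℂ] H :=
  LinearMap.mkContinuous
    { toFun := fun x => ∫ g, f g • (U.toHom g : H →L[ℂ] H) x ∂(Measure.haar : Measure G)
      map_add' := fun x y => by
        simp only [map_add, smul_add]
        exact integral_add (U.integrable f x) (U.integrable f y)
      map_smul' := fun c x => by
        simp only [map_smul, RingHom.id_apply]
        rw [← integral_smul]
        refine integral_congr_ae (Eventually.of_forall fun g => ?_)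
        exact smul_comm _ _ _ }
    (∫ g, ‖f g‖ ∂(Measure.haar : Measure G))
    (fun x => by
      refine (norm_integral_le_integral_norm _).trans_eq ?_
      simp only [norm_smul, U.norm_apply]
      rw [integral_mul_const])

theorem UnitaryRep.integrated_apply {H : Type*} [NormedAddCommGroup H] [InnerProductSpace ℂ H]
    [CompleteSpace H] (U : UnitaryRep G H) (f : C_c(G, ℂ)) (x : H) :
    U.integrated f x = ∫ g, f g • (U.toHom g : H →L[ℂ] H) x ∂(Measure.haar : Measure G) := rfl

theorem UnitaryRep.norm_integrated_le {H : Type*} [NormedAddCommGroup H] [InnerProductSpace ℂ H]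
    [CompleteSpace H] (U : UnitaryRep G H) (f : C_c(G, ℂ)) :
    ‖U.integrated f‖ ≤ ∫ g, ‖f g‖ ∂(Measure.haar : Measure G) :=
  LinearMap.mkContinuous_norm_le _ (integral_nonneg fun _ => norm_nonneg _) _

/-- The image of `f` in `C_c(G)` under the universal representation: the family `(U_i(f))`. -/
def universalIntegrated (f : C_c(G, ℂ)) : UniversalAlgebra G :=
  ⟨fun i => i.rep.integrated f, memℓp_infty
    ⟨∫ g, ‖f g‖ ∂(Measure.haar : Measure G), by
      rintro _ ⟨i, rfl⟩
      exact i.rep.norm_integrated_le f⟩⟩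

variable (G) in
/-- The group C*-algebra `C*(G)`: the C*-algebra generated by the image of `C_c(G)` under the
universal representation; equivalently, the completion of `C_c(G)` (or of `L¹(G)`) in the norm
`‖f‖ = sup_U ‖U(f)‖`, the supremum being over all strongly continuous unitary representations. -/
def groupCStarSubalgebra : NonUnitalStarSubalgebra ℂ (UniversalAlgebra G) :=
  (NonUnitalStarAlgebra.adjoin ℂ (Set.range (universalIntegrated (G := G)))).topologicalClosure

variable (G) in
/-- The group C*-algebra `C*(G)` as a type. -/
abbrev GroupCStar : Type (u + 1) := groupCStarSubalgebra G

instance : NonUnitalCStarAlgebra (GroupCStar G) :=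
  NonUnitalStarSubalgebra.nonUnitalCStarAlgebra (groupCStarSubalgebra G)
    (h_closed := NonUnitalStarSubalgebra.isClosed_topologicalClosure _)

/-- The left translate `s ↦ f(g⁻¹ s)`. -/
def translate (g : G) (f : C_c(G, ℂ)) : C_c(G, ℂ) where
  toFun := fun s => f (g⁻¹ * s)
  continuous_toFun := f.continuous.comp (continuous_const_mul g⁻¹)
  hasCompactSupport' := f.hasCompactSupport.comp_homeomorph (Homeomorph.mulLeft g⁻¹)

theorem universalUnitary_mul_integrated (g : G) (f : C_c(G, ℂ)) :
    universalUnitary g * universalIntegrated f = universalIntegrated (translate g f) := by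
  refine lp.ext (funext fun i => ContinuousLinearMap.ext fun x => ?_)
  change (i.rep.toHom g : i.space →L[ℂ] i.space) (i.rep.integrated f x) =
    i.rep.integrated (translate g f) x
  rw [UnitaryRep.integrated_apply, UnitaryRep.integrated_apply,
    ← ContinuousLinearMap.integral_comp_comm _ (i.rep.integrable f x),
    ← integral_mul_left_eq_self
      (fun s => translate g f s • (i.rep.toHom s : i.space →L[ℂ] i.space) x) g]
  refine integral_congr_ae (Eventually.of_forall fun s => ?_)
  change (i.rep.toHom g : i.space →L[ℂ] i.space) (f s • (i.rep.toHom s : i.space →L[ℂ] i.space) x)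
    = f (g⁻¹ * (g * s)) • (i.rep.toHom (g * s) : i.space →L[ℂ] i.space) x
  rw [map_smul, inv_mul_cancel_left, map_mul]
  rfl

/-- The right translate `s ↦ f(s g⁻¹)`. -/
def rightTranslate (g : G) (f : C_c(G, ℂ)) : C_c(G, ℂ) where
  toFun := fun s => f (s * g⁻¹)
  continuous_toFun := f.continuous.comp (continuous_mul_const g⁻¹)
  hasCompactSupport' := f.hasCompactSupport.comp_homeomorph (Homeomorph.mulRight g⁻¹)

theorem universalIntegrated_mul_unitary (g : G) (f : C_c(G, ℂ)) :
    ∃ c : ℂ, universalIntegrated f * universalUnitary g =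
      c • universalIntegrated (rightTranslate g f) := by
  let μ : Measure G := Measure.haar
  have : (Measure.map (fun s => s * g) μ).Regular :=
    Measure.Regular.map (Homeomorph.mulRight g)
  obtain ⟨c, hc⟩ : ∃ c : NNReal, Measure.map (fun s => s * g) μ = c • μ :=
    ⟨_, Measure.isMulLeftInvariant_eq_smul_of_regular _ _⟩
  refine ⟨((c : ℝ) : ℂ), lp.ext (funext fun i => ContinuousLinearMap.ext fun x => ?_)⟩
  change i.rep.integrated f ((i.rep.toHom g : i.space →L[ℂ] i.space) x) =
    ((c : ℝ) : ℂ) • i.rep.integrated (rightTranslate g f) x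
  rw [UnitaryRep.integrated_apply, UnitaryRep.integrated_apply]
  have h : ∫ s, rightTranslate g f s • (i.rep.toHom s : i.space →L[ℂ] i.space) x
      ∂(Measure.map (fun s => s * g) μ) =
      ∫ s, rightTranslate g f (s * g) • (i.rep.toHom (s * g) : i.space →L[ℂ] i.space) x ∂μ :=
    (Homeomorph.mulRight g).measurableEmbedding.integral_map _
  rw [hc, integral_smul_nnreal_measure] at h
  rw [Complex.coe_smul]
  refine Eq.trans ?_ h.symm
  refine integral_congr_ae (Eventually.of_forall fun s => ?_)
  change _ = f (s * g * g⁻¹) • _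
  rw [mul_inv_cancel_right, map_mul]
  rfl

theorem unitary_mul_mem_aux (x : UniversalAlgebra G)
    (hx : x ∈ NonUnitalStarAlgebra.adjoin ℂ (Set.range (universalIntegrated (G := G)))) :
    ∀ g : G, universalUnitary g * x ∈
        NonUnitalStarAlgebra.adjoin ℂ (Set.range (universalIntegrated (G := G))) ∧
      x * universalUnitary g ∈
        NonUnitalStarAlgebra.adjoin ℂ (Set.range (universalIntegrated (G := G))) := by
  induction hx using NonUnitalStarAlgebra.adjoin_induction with
  | mem x hx =>
    obtain ⟨f, rfl⟩ := hx
    refine fun g => ⟨?_, ?_⟩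
    · rw [universalUnitary_mul_integrated]
      exact NonUnitalStarAlgebra.subset_adjoin ℂ _ ⟨_, rfl⟩
    · obtain ⟨c, hc⟩ := universalIntegrated_mul_unitary g f
      rw [hc]
      exact SMulMemClass.smul_mem c (NonUnitalStarAlgebra.subset_adjoin ℂ _ ⟨_, rfl⟩)
  | add x y _ _ hx hy =>
    refine fun g => ⟨?_, ?_⟩
    · rw [mul_add]; exact add_mem (hx g).1 (hy g).1
    · rw [add_mul]; exact add_mem (hx g).2 (hy g).2
  | zero => simp
  | mul x y hx' hy' hx hy =>
    refine fun g => ⟨?_, ?_⟩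
    · rw [← mul_assoc]; exact mul_mem (hx g).1 hy'
    · rw [mul_assoc]; exact mul_mem hx' (hy g).2
  | smul c x _ hx =>
    refine fun g => ⟨?_, ?_⟩
    · rw [mul_smul_comm]; exact SMulMemClass.smul_mem c (hx g).1
    · rw [smul_mul_assoc]; exact SMulMemClass.smul_mem c (hx g).2
  | star x _ hx =>
    refine fun g => ⟨?_, ?_⟩
    · have h := star_mem (hx g⁻¹).2
      rwa [star_mul, star_universalUnitary, inv_inv] at h
    · have h := star_mem (hx g⁻¹).1
      rwa [star_mul, star_universalUnitary, inv_inv] at h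

theorem unitary_mul_mem (g : G) {x : UniversalAlgebra G} (hx : x ∈ groupCStarSubalgebra G) :
    universalUnitary g * x ∈ groupCStarSubalgebra G :=
  map_mem_closure (f := fun y => universalUnitary g * y)
    (continuous_const_mul (universalUnitary g)) hx
    fun y hy => (unitary_mul_mem_aux y hy g).1

theorem mul_unitary_mem (g : G) {x : UniversalAlgebra G} (hx : x ∈ groupCStarSubalgebra G) :
    x * universalUnitary g ∈ groupCStarSubalgebra G :=
  map_mem_closure (f := fun y => y * universalUnitary g)
    (continuous_mul_const (universalUnitary g)) hx
    fun y hy => (unitary_mul_mem_aux y hy g).2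

/-- The multiplier of `C*(G)` given by left and right multiplication by the family `(U_i(g))`. -/
def groupMultiplier (g : G) : 𝓜(ℂ, GroupCStar G) where
  fst := (((ContinuousLinearMap.mul ℂ (UniversalAlgebra G)) (universalUnitary g)).comp
    (groupCStarSubalgebra G).toSubmodule.subtypeL).codRestrict
      (groupCStarSubalgebra G).toSubmodule fun x => unitary_mul_mem g x.2
  snd := (((ContinuousLinearMap.mul ℂ (UniversalAlgebra G)).flip (universalUnitary g)).comp
    (groupCStarSubalgebra G).toSubmodule.subtypeL).codRestrict
      (groupCStarSubalgebra G).toSubmodule fun x => mul_unitary_mem g x.2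
  central := fun _ _ => Subtype.ext (mul_assoc _ _ _)

theorem groupMultiplier_fst_coe (g : G) (x : GroupCStar G) :
    (((groupMultiplier g).fst x : GroupCStar G) : UniversalAlgebra G) =
      universalUnitary g * (x : UniversalAlgebra G) := rfl

theorem groupMultiplier_one : groupMultiplier (1 : G) = 1 := by
  refine ext_fst (ContinuousLinearMap.ext fun x => Subtype.ext ?_)
  rw [groupMultiplier_fst_coe, universalUnitary_one_mul]
  rfl

theorem groupMultiplier_mul (g h : G) :
    groupMultiplier (g * h) = groupMultiplier g * groupMultiplier h := by
  refine ext_fst (ContinuousLinearMap.ext fun x => Subtype.ext ?_)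
  rw [groupMultiplier_fst_coe, universalUnitary_mul, mul_assoc]
  rfl

theorem star_groupMultiplier (g : G) : star (groupMultiplier g) = groupMultiplier g⁻¹ := by
  refine ext_fst (ContinuousLinearMap.ext fun x => Subtype.ext ?_)
  rw [groupMultiplier_fst_coe, DoubleCentralizer.star_fst, ← star_universalUnitary]
  change star (star (x : UniversalAlgebra G) * universalUnitary g) = _
  rw [star_mul, star_star]

/-- The canonical homomorphism `η : G → U(M(C*(G)))`; on functions, `η(g) f = f(g⁻¹ ·)`. -/
def canonicalHom (G : Type u) [Group G] [TopologicalSpace G] [IsTopologicalGroup G]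
    [LocallyCompactSpace G] [MeasurableSpace G] [BorelSpace G] :
    G →* unitary 𝓜(ℂ, GroupCStar G) where
  toFun g := ⟨groupMultiplier g, by
    rw [Unitary.mem_iff, star_groupMultiplier, ← groupMultiplier_mul, ← groupMultiplier_mul,
      inv_mul_cancel, mul_inv_cancel, groupMultiplier_one]
    exact ⟨rfl, rfl⟩⟩
  map_one' := Subtype.ext groupMultiplier_one
  map_mul' g h := Subtype.ext (groupMultiplier_mul g h)

end GroupAlgebra

/-! ### Crossed product hosts -/

section CrossedProductHost

variable {G : Type u} [Group G] [TopologicalSpace G] [IsTopologicalGroup G]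
  [LocallyCompactSpace G] [MeasurableSpace G] [BorelSpace G]
  {A : Type v} [NonUnitalCStarAlgebra A] {B : Type w} [NonUnitalCStarAlgebra B]

/-- `(B, η_A, η_L)` is a crossed product host for `(α, C*(G))`, where `α` is an action of `G` on
`A` by *-automorphisms, without any continuity assumption. -/
structure IsCrossedProductHost (α : G →* (A ≃⋆ₐ[ℂ] A))
    (ηA : A →⋆ₙₐ[ℂ] 𝓜(ℂ, B)) (ηL : GroupCStar G →⋆ₙₐ[ℂ] 𝓜(ℂ, B)) : Prop where
  /-- `η_L` is non-degenerate. -/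
  nonDegenerate : IsNonDegenerate ηL
  /-- Covariance: `η̃_L(η(g)) η_A(a) η̃_L(η(g))* = η_A(α_g(a))`. -/
  covariant : ∀ (a : A) (g : G),
    multiplierExtension ηL nonDegenerate (canonicalHom G g) * ηA a *
      star (multiplierExtension ηL nonDegenerate (canonicalHom G g)) = ηA (α g a)
  /-- `η_A(A) η_L(C*(G))` is contained in `B`. -/
  mul_mem : ∀ (a : A) (l : GroupCStar G), ∃ b : B, (b : 𝓜(ℂ, B)) = ηA a * ηL l
  /-- `B` is generated as a C*-algebra by `η_A(A) η_L(C*(G))`. -/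
  generates : (NonUnitalStarAlgebra.adjoin ℂ
    {b : B | ∃ (a : A) (l : GroupCStar G), (b : 𝓜(ℂ, B)) = ηA a * ηL l}).topologicalClosure = ⊤

/-- `(B, η_A, η_L)` is a full crossed product host for `(α, C*(G))`: for every covariant
representation `(π, U)` of `(A, G, α)` on a Hilbert space `H`, with `U_L` the non-degenerate
representation of `C*(G)` corresponding to `U` (that is, `Ũ_L ∘ η = U`), there is a unique
representation `ρ` of `B` on `H` with `ρ(η_A(a) η_L(l)) = π(a) U_L(l)`. -/
structure IsFullCrossedProductHost (α : G →* (A ≃⋆ₐ[ℂ] A))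
    (ηA : A →⋆ₙₐ[ℂ] 𝓜(ℂ, B)) (ηL : GroupCStar G →⋆ₙₐ[ℂ] 𝓜(ℂ, B)) : Prop
    extends IsCrossedProductHost α ηA ηL where
  existsUnique_rep : ∀ (H : Type u) [NormedAddCommGroup H] [InnerProductSpace ℂ H]
    [CompleteSpace H] (π : A →⋆ₙₐ[ℂ] (H →L[ℂ] H)) (U : UnitaryRep G H)
    (UL : GroupCStar G →⋆ₙₐ[ℂ] (H →L[ℂ] H)) (hUL : IsNonDegenerateRep UL),
    IsNonDegenerateRep π →
    (∀ (g : G) (a : A), (U.toHom g : H →L[ℂ] H) * π a * star (U.toHom g : H →L[ℂ] H) =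
      π (α g a)) →
    (∀ g : G, repExtension UL hUL (canonicalHom G g) = (U.toHom g : H →L[ℂ] H)) →
    ∃! ρ : B →⋆ₙₐ[ℂ] (H →L[ℂ] H), ∀ (a : A) (l : GroupCStar G) (b : B),
      (b : 𝓜(ℂ, B)) = ηA a * ηL l → ρ b = π a * UL l

end CrossedProductHost

end CPHost

end

/-! The host is known only through its representations on Hilbert spaces, so the homomorphism into
$M(\mathcal C)$ is found inside a faithful representation of $M(\mathcal C)$. The GNS
representations $\pi_f$ of $\mathcal C$, over all positive functionals $f$, extend to $M(\mathcal
C)$ and jointly separate multipliers (`multiplier_ext_gns`), so $M(\mathcal C)$ embeds in the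
bounded product of the $B(\mathcal H_f)$.

For each $f$ the pair $(\widetilde\pi_f\circ\phi,\ \widetilde\pi_f\circ U)$ is covariant, and the
host supplies a representation $\rho_f$ of $\mathcal B$. The family $(\rho_f)$ maps a generator
$\eta_{\mathcal A}(A)\eta_{\mathcal L}(L)$ to the image of the multiplier $\phi(A)m_L$, where
$m_L\in M(\mathcal C)$ realises the integrated form of $U$: a strict integral $\int k(s)U(s)\,ds$
for $L=k\in C_c(G)$, a limit in general. An injective *-homomorphism of C*-algebras has closed range
(`exists_eq_of_mem_closure_adjoin`), so all of $\mathcal B$ lands in $M(\mathcal C)$, which defines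
$\rho$.

Functions $k$ concentrated near $1$ show that $\rho(\mathcal B)\mathcal C$ is total in $\mathcal C$
(`mem_closure_range_integral`), hence $\rho$ is non-degenerate. The two identities for
$\widetilde\rho$ are then checked on generators. -/

noncomputable section

namespace CPHost

/-! ### Positive functionals and GNS representations of a non-unital C*-algebra. -/

section GNS

variable {C : Type*} [NonUnitalCStarAlgebra C] [PartialOrder C] [StarOrderedRing C]

open scoped ComplexOrder in
/-- A nonzero positive element is detected by a positive functional. -/
theorem exists_positiveLinearMap_ne_zero {h : C} (h0 : 0 ≤ h) (hne : h ≠ 0) :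
    ∃ f : C →ₚ[ℂ] ℂ, f h ≠ 0 := by
  -- The positive cone is closed and convex, and it misses $-h$; Hahn–Banach separates the two.
  -- Scaling inside the cone then forces the real part of the functional to be nonnegative on it.
  have hnot : -h ∉ {a : C | 0 ≤ a} := fun hm => hne (le_antisymm (neg_nonneg.1 hm) h0)
  obtain ⟨f, s, hs, hf⟩ := RCLike.geometric_hahn_banach_point_closed (𝕜 := ℂ)
    (t := {a : C | 0 ≤ a}) (convex_Ici (𝕜 := ℝ) (0 : C)) CStarAlgebra.isClosed_nonneg hnot
  have hs0 : s < 0 := by simpa using hf 0 le_rfl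
  have hpos : ∀ a : C, 0 ≤ a → 0 ≤ (f a).re := by
    intro a ha
    by_contra! hlt
    have h1 := hf ((s / (f a).re) • a) (smul_nonneg (div_nonneg_of_nonpos hs0.le hlt.le) ha)
    rw [← Complex.coe_smul, map_smul] at h1
    simp [div_mul_cancel₀ _ hlt.ne] at h1
  -- Only the real part of `f` is controlled. The symmetrisation is complex linear and equals
  -- $2\,\mathrm{Re}\,f$ on self-adjoint elements, so it is real on the cone.
  let g : C →ₗ[ℂ] ℂ :=
    { toFun := fun x => f x + star (f (star x))
      map_add' := fun x y => by simp; ring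
      map_smul' := fun c x => by simp; ring }
  have hg : ∀ a : C, 0 ≤ a → g a = ((2 * (f a).re : ℝ) : ℂ) := fun a ha => by
    change f a + star (f (star a)) = _
    rw [(IsSelfAdjoint.of_nonneg ha).star_eq]
    simpa using Complex.add_conj (f a)
  refine ⟨PositiveLinearMap.mk₀ g fun a ha => ?_, ?_⟩
  · rw [hg a ha]
    exact_mod_cast mul_nonneg zero_le_two (hpos a ha)
  · change g h ≠ 0
    rw [hg h h0]
    have h2 : 0 < (f h).re := by
      have := hs.trans hs0
      simpa using this
    exact_mod_cast (mul_pos two_pos h2).ne'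

open scoped ComplexOrder in
-- The GNS seminorm $f(a^*a)^{1/2}$ is norm continuous because positive functionals are bounded.
-- Hence $u_\lambda x\to x$ in the pre-GNS space for an approximate unit, and that space is dense.
theorem isNonDegenerateRep_gns (f : C →ₚ[ℂ] ℂ) :
    IsNonDegenerateRep f.gnsNonUnitalStarAlgHom := by
  obtain ⟨l, hl, -⟩ := exists_approximateUnit C
  have := hl.neBot
  have hnorm : Continuous fun a : C => ‖f.toPreGNS a‖ := by
    simp only [PositiveLinearMap.preGNS_norm_def, PositiveLinearMap.ofPreGNS_toPreGNS]
    have hf : Continuous f := map_continuous f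
    exact Real.continuous_sqrt.comp (Complex.continuous_re.comp
      (hf.comp (continuous_star.mul continuous_id)))
  have hcoe : ∀ x : f.PreGNS, (x : f.GNS) ∈ closure (Submodule.span ℂ
      {y : f.GNS | ∃ (a : C) (x : f.GNS), f.gnsNonUnitalStarAlgHom a x = y} : Set f.GNS) := by
    intro x
    refine mem_closure_of_tendsto (b := l)
      (f := fun a : C => f.gnsNonUnitalStarAlgHom a (x : f.GNS)) ?_
      (Eventually.of_forall fun a => Submodule.subset_span ⟨a, x, rfl⟩)
    simp only [PositiveLinearMap.gnsNonUnitalStarAlgHom_apply_coe]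
    refine (UniformSpace.Completion.continuous_coe f.PreGNS).continuousAt.tendsto.comp ?_
    rw [tendsto_iff_norm_sub_tendsto_zero]
    have h1 : Tendsto (fun a : C => a * f.ofPreGNS x - f.ofPreGNS x) l (𝓝 0) := by
      simpa using (hl.tendsto_mul_right (f.ofPreGNS x)).sub_const (f.ofPreGNS x)
    have h2 := (hnorm.tendsto 0).comp h1
    simpa [Function.comp_def, map_sub] using h2
  intro x
  refine closure_minimal ?_ isClosed_closure (UniformSpace.Completion.denseRange_coe x)
  rintro _ ⟨y, rfl⟩
  exact hcoe y

open scoped ComplexOrder in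
-- Without a unit, the class of $a^*$ serves as test vector: $\pi_f(a)[a^*]=[aa^*]$ has squared norm
-- $f((aa^*)^*(aa^*))$, and the C*-identity used twice makes that argument of `f` nonzero.
theorem exists_gns_ne_zero {a : C} (ha : a ≠ 0) :
    ∃ f : C →ₚ[ℂ] ℂ, f.gnsNonUnitalStarAlgHom a ≠ 0 := by
  have h1 : a * star a ≠ 0 := fun h => ha (CStarRing.mul_star_self_eq_zero_iff _ |>.1 h)
  have h2 : star (a * star a) * (a * star a) ≠ 0 := fun h =>
    h1 (CStarRing.star_mul_self_eq_zero_iff _ |>.1 h)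
  obtain ⟨f, hf⟩ := exists_positiveLinearMap_ne_zero (star_mul_self_nonneg _) h2
  refine ⟨f, fun h0 => hf ?_⟩
  have h3 := DFunLike.congr_fun h0 ((f.toPreGNS (star a) : f.PreGNS) : f.GNS)
  have h4 := f.preGNS_norm_sq (f.toPreGNS (a * star a))
  rw [PositiveLinearMap.gnsNonUnitalStarAlgHom_apply_coe] at h3
  have h5 : ‖((f.leftMulMapPreGNS a (f.toPreGNS (star a)) : f.PreGNS) : f.GNS)‖ = 0 := by
    rw [h3]; simp
  rw [UniformSpace.Completion.norm_coe] at h5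
  have h6 : f.leftMulMapPreGNS a (f.toPreGNS (star a)) = f.toPreGNS (a * star a) := by simp
  rw [h6] at h5
  rw [h5] at h4
  simpa using h4.symm

end GNS

/-! ### Factoring homomorphisms through an injective one; bounded products. -/

section Lifting

variable {D E M : Type*} [NonUnitalCStarAlgebra D] [NonUnitalCStarAlgebra E]
  [NonUnitalCStarAlgebra M]

/-- If `Ψ` is injective and its range contains `R(S)`, then it contains the image under `R` of the
C*-algebra generated by `S`. -/
theorem exists_eq_of_mem_closure_adjoin {Ψ : M →⋆ₙₐ[ℂ] E} (hΨ : Function.Injective Ψ)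
    (R : D →⋆ₙₐ[ℂ] E) {S : Set D} (hS : ∀ s ∈ S, ∃ m, Ψ m = R s) {x : D}
    (hx : x ∈ (NonUnitalStarAlgebra.adjoin ℂ S).topologicalClosure) : ∃ m, Ψ m = R x := by
  -- Injective *-homomorphisms of C*-algebras are isometric, so the range is closed; only the
  -- *-algebra generated by `S` remains to be treated.
  have hcl : IsClosed {x : D | ∃ m, Ψ m = R x} :=
    (NonUnitalStarAlgHom.isometry Ψ hΨ).isClosedEmbedding.isClosed_range.preimage
      (continuous_hom R)
  refine closure_minimal (fun y hy => ?_) hcl hx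
  change ∃ m, Ψ m = R y
  induction hy using NonUnitalStarAlgebra.adjoin_induction with
  | mem x hx => exact hS x hx
  | add x y _ _ hx hy =>
    obtain ⟨m, hm⟩ := hx
    obtain ⟨n, hn⟩ := hy
    exact ⟨m + n, by rw [map_add, map_add, hm, hn]⟩
  | zero => exact ⟨0, by simp⟩
  | mul x y _ _ hx hy =>
    obtain ⟨m, hm⟩ := hx
    obtain ⟨n, hn⟩ := hy
    exact ⟨m * n, by rw [map_mul, map_mul, hm, hn]⟩
  | smul c x _ hx =>
    obtain ⟨m, hm⟩ := hx
    exact ⟨c • m, by rw [map_smul, map_smul, hm]⟩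
  | star x _ hx =>
    obtain ⟨m, hm⟩ := hx
    exact ⟨star m, by rw [map_star, map_star, hm]⟩

/-- A homomorphism with values in the range of an injective homomorphism factors through it. -/
theorem exists_hom_comp_eq {Ψ : M →⋆ₙₐ[ℂ] E} (hΨ : Function.Injective Ψ)
    (R : D →⋆ₙₐ[ℂ] E) (hR : ∀ d, ∃ m, Ψ m = R d) : ∃ ρ : D →⋆ₙₐ[ℂ] M, ∀ d, Ψ (ρ d) = R d := by
  choose ρ hρ using hR
  exact ⟨{ toFun := ρ
           map_smul' := fun c x => hΨ (by simp [hρ])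
           map_zero' := hΨ (by simp [hρ])
           map_add' := fun x y => hΨ (by simp [hρ])
           map_mul' := fun x y => hΨ (by simp [hρ])
           map_star' := fun x => hΨ (by simp [hρ, map_star]) }, hρ⟩

/-- The C*-algebra of bounded families in a family of C*-algebras. -/
def BoundedProduct {ι : Type*} (F : ι → Type*) [∀ i, NonUnitalCStarAlgebra (F i)] : Type _ :=
  lp F ∞

instance {ι : Type*} (F : ι → Type*) [∀ i, NonUnitalCStarAlgebra (F i)] :
    NonUnitalCStarAlgebra (BoundedProduct F) :=
  inferInstanceAs (NonUnitalCStarAlgebra (lp F ∞))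

/-- The homomorphism into the bounded product given by a family of homomorphisms. -/
def boundedProductHom {ι : Type*} {F : ι → Type*} [∀ i, NonUnitalCStarAlgebra (F i)]
    (φ : ∀ i, D →⋆ₙₐ[ℂ] F i) : D →⋆ₙₐ[ℂ] BoundedProduct F where
  toFun d := ⟨fun i => φ i d, memℓp_infty ⟨‖d‖, by
    rintro _ ⟨i, rfl⟩
    exact NonUnitalStarAlgHom.norm_apply_le (φ i) d⟩⟩
  map_smul' c x := lp.ext (funext fun i => map_smul (φ i) c x)
  map_zero' := lp.ext (funext fun i => map_zero (φ i))
  map_add' x y := lp.ext (funext fun i => map_add (φ i) x y)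
  map_mul' x y := lp.ext (funext fun i => map_mul (φ i) x y)
  map_star' x := lp.ext (funext fun i => map_star (φ i) x)

theorem boundedProductHom_eq_iff {ι : Type*} {F : ι → Type*} [∀ i, NonUnitalCStarAlgebra (F i)]
    {φ : ∀ i, D →⋆ₙₐ[ℂ] F i} {ψ : ∀ i, M →⋆ₙₐ[ℂ] F i} {d : D} {m : M} :
    boundedProductHom φ d = boundedProductHom ψ m ↔ ∀ i, φ i d = ψ i m :=
  ⟨fun h i => congrFun (congrArg Subtype.val h) i, fun h => lp.ext (funext h)⟩

end Lifting

/-! ### Computing with extensions to multiplier algebras; criteria for non-degeneracy. -/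

section Extension

variable {A B : Type*} [NonUnitalCStarAlgebra A] [NonUnitalCStarAlgebra B]
  {H : Type*} [NormedAddCommGroup H] [InnerProductSpace ℂ H] [CompleteSpace H]

theorem star_snd_star (m : 𝓜(ℂ, A)) (a : A) : m.snd a = star ((star m).fst (star a)) := by
  simp

theorem repExtension_apply (π : A →⋆ₙₐ[ℂ] (H →L[ℂ] H)) (hπ : IsNonDegenerateRep π)
    (m : 𝓜(ℂ, A)) (a : A) (x : H) : repExtension π hπ m (π a x) = π (m.fst a) x := by
  rw [← repExtension_coe π hπ a, ← repExtension_coe π hπ (m.fst a), ← mul_coe, map_mul]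
  rfl

theorem multiplierExtension_fst (φ : A →⋆ₙₐ[ℂ] 𝓜(ℂ, B)) (hφ : IsNonDegenerate φ)
    (m : 𝓜(ℂ, A)) (a : A) (b : B) :
    (multiplierExtension φ hφ m).fst ((φ a).fst b) = (φ (m.fst a)).fst b := by
  rw [← multiplierExtension_coe φ hφ a, ← multiplierExtension_coe φ hφ (m.fst a), ← mul_coe,
    map_mul]
  rfl

theorem repExtension_eq_of_forall {π : A →⋆ₙₐ[ℂ] (H →L[ℂ] H)} (hπ : IsNonDegenerateRep π)
    {m : 𝓜(ℂ, A)} {T : H →L[ℂ] H} (h : ∀ a x, T (π a x) = π (m.fst a) x) :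
    repExtension π hπ m = T := by
  refine ContinuousLinearMap.ext_on hπ ?_
  rintro _ ⟨a, x, rfl⟩
  rw [repExtension_apply, h]

/-- `π̃` as a non-unital homomorphism. -/
def repExtensionHom (π : A →⋆ₙₐ[ℂ] (H →L[ℂ] H)) (hπ : IsNonDegenerateRep π) :
    𝓜(ℂ, A) →⋆ₙₐ[ℂ] (H →L[ℂ] H) :=
  (repExtension π hπ : 𝓜(ℂ, A) →⋆ₙₐ[ℂ] (H →L[ℂ] H))

theorem repExtensionHom_apply (π : A →⋆ₙₐ[ℂ] (H →L[ℂ] H)) (hπ : IsNonDegenerateRep π)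
    (m : 𝓜(ℂ, A)) : repExtensionHom π hπ m = repExtension π hπ m := rfl

/-- The composition of a non-degenerate representation with a non-degenerate homomorphism is
non-degenerate. -/
theorem isNonDegenerateRep_comp {π : B →⋆ₙₐ[ℂ] (H →L[ℂ] H)} (hπ : IsNonDegenerateRep π)
    {φ : A →⋆ₙₐ[ℂ] 𝓜(ℂ, B)} (hφ : IsNonDegenerate φ) :
    IsNonDegenerateRep ((repExtensionHom π hπ).comp φ) := by
  obtain ⟨l, hl, -, h, -⟩ := hφ
  have := hl.neBot
  let K : Submodule ℂ H := Submodule.span ℂ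
    {y : H | ∃ (a : A) (x : H), (repExtensionHom π hπ).comp φ a x = y}
  have hK : (Submodule.span ℂ {y : H | ∃ (b : B) (x : H), π b x = y}) ≤ K.topologicalClosure := by
    rw [Submodule.span_le]
    rintro _ ⟨b, x, rfl⟩
    -- $\widetilde\pi(\phi(u_\lambda))\pi(b)x=\pi(\phi(u_\lambda)b)x\to\pi(b)x$.
    have hc : Continuous fun c => π c x := (continuous_hom π).clm_apply continuous_const
    refine mem_closure_of_tendsto ((hc.tendsto b).comp (h b)) (Eventually.of_forall fun a => ?_)
    refine Submodule.subset_span ⟨a, π b x, ?_⟩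
    exact repExtension_apply π hπ (φ a) b x
  intro x
  exact closure_minimal hK isClosed_closure (hπ x)

/-- A homomorphism `φ : A → M(B)` with `φ(A)B` total in `B` is non-degenerate. -/
theorem isNonDegenerate_of_dense {φ : A →⋆ₙₐ[ℂ] 𝓜(ℂ, B)}
    (hd : Dense (Submodule.span ℂ {y : B | ∃ (a : A) (x : B), (φ a).fst x = y} : Set B)) :
    IsNonDegenerate φ := by
  obtain ⟨l, hl, hl1⟩ := exists_approximateUnit A
  -- The map `u` is taken to be `id` for convergence of $\phi(a)b$, and `star` for convergence of
  -- $b\,\phi(a)=(\phi(a^*)b^*)^*$. Contractivity of `u` and $\phi$ carries the limit from the dense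
  -- span to all of `B`.
  have key : ∀ u : A → A, (∀ a, ‖u a‖ ≤ ‖a‖) → (∀ a, Tendsto (fun x => u x * a) l (𝓝 a)) →
      ∀ b : B, Tendsto (fun a => (φ (u a)).fst b) l (𝓝 b) := by
    intro u hu ht
    have hspan : ∀ z ∈ Submodule.span ℂ {y : B | ∃ (a : A) (x : B), (φ a).fst x = y},
        Tendsto (fun a => (φ (u a)).fst z) l (𝓝 z) := by
      intro z hz
      induction hz using Submodule.span_induction with
      | mem z hz =>
        obtain ⟨a, x, rfl⟩ := hz
        have hc : Continuous fun a => (φ a).fst x :=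
          (continuous_fst.comp (continuous_hom φ)).clm_apply continuous_const
        have h1 := (hc.tendsto a).comp (ht a)
        refine h1.congr fun y => ?_
        simp only [Function.comp_apply, map_mul]
        rfl
      | zero => simpa using tendsto_const_nhds
      | add x y _ _ hx hy => simpa using hx.add hy
      | smul c x _ hx => simpa using hx.const_smul c
    intro b
    rw [Metric.tendsto_nhds]
    intro ε hε
    obtain ⟨z, hz, hbz⟩ := Metric.dense_iff.1 hd b (ε / 3) (by positivity)
    have h3 := (Metric.tendsto_nhds.1 (hspan z hbz)) (ε / 3) (by positivity)
    filter_upwards [h3, hl1] with a ha ha1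
    have h4 : dist ((φ (u a)).fst b) ((φ (u a)).fst z) ≤ dist b z := by
      rw [dist_eq_norm, dist_eq_norm, ← map_sub]
      refine ((φ (u a)).fst.le_opNorm _).trans (mul_le_of_le_one_left (norm_nonneg _) ?_)
      rw [DoubleCentralizer.norm_fst]
      exact (NonUnitalStarAlgHom.norm_apply_le φ _).trans ((hu a).trans ha1)
    have h5 : dist b z < ε / 3 := by rw [dist_comm]; exact hz
    calc dist ((φ (u a)).fst b) b ≤ dist ((φ (u a)).fst b) ((φ (u a)).fst z) +
          dist ((φ (u a)).fst z) z + dist z b := dist_triangle4 _ _ _ _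
      _ < ε := by rw [dist_comm z b]; linarith
  refine ⟨l, hl, hl1, key id (fun _ => le_rfl) hl.tendsto_mul_right, fun b => ?_⟩
  have h1 := key star (fun a => (norm_star a).le) (fun a => by
    simpa [Function.comp_def] using
      (continuous_star.tendsto _).comp (hl.tendsto_mul_left (star a))) (star b)
  have h2 := (continuous_star.tendsto _).comp h1
  rw [star_star] at h2
  refine h2.congr fun a => ?_
  rw [Function.comp_apply, star_snd_star (φ a), map_star φ]

/-- An extension is determined on $\phi(S)B$ once this is total. The freedom in `S` matters because
$\rho$ is known explicitly only on the generators of the host. -/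
theorem multiplierExtension_eq_of_forall {φ : A →⋆ₙₐ[ℂ] 𝓜(ℂ, B)} (hφ : IsNonDegenerate φ)
    {S : Set A} (hS : Dense (Submodule.span ℂ {y : B | ∃ a ∈ S, ∃ x : B, (φ a).fst x = y} : Set B))
    {m : 𝓜(ℂ, A)} {n : 𝓜(ℂ, B)} (h : ∀ a ∈ S, φ (m.fst a) = n * φ a) :
    multiplierExtension φ hφ m = n := by
  refine ext_fst (ContinuousLinearMap.ext_on hS ?_)
  rintro _ ⟨a, ha, x, rfl⟩
  rw [multiplierExtension_fst, h a ha]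
  rfl

end Extension

/-! ### Approximate identities in $C_c(G)$ and integrated representations of $C^*(G)$. -/

section Integration

variable {G : Type u} [Group G] [TopologicalSpace G] [IsTopologicalGroup G]
  [LocallyCompactSpace G] [MeasurableSpace G] [BorelSpace G]

/-- A continuous function `F` on `G` is approximated at `1` by its integrals against functions in
`C_c(G)`. -/
theorem mem_closure_range_integral {E : Type*} [NormedAddCommGroup E] [NormedSpace ℂ E]
    [CompleteSpace E] {F : G → E} (hF : Continuous F) :
    F 1 ∈ closure (Set.range fun f : C_c(G, ℂ) => ∫ s, f s • F s ∂(Measure.haar : Measure G)) := by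
  rw [Metric.mem_closure_range_iff]
  intro ε hε
  let V : Set G := {s | dist (F s) (F 1) < ε / 2}
  have hV : IsOpen V := isOpen_lt (hF.dist continuous_const) continuous_const
  have h1 : (1 : G) ∈ V := by simp [V, hε]
  obtain ⟨f, hf1, hf0, hfc, hf⟩ := exists_continuous_one_zero_of_isCompact
    (isCompact_singleton (x := (1 : G))) hV.isClosed_compl
    (Set.disjoint_singleton_left.2 fun h => h h1)
  let μ : Measure G := Measure.haar
  have hI : 0 < ∫ s, f s ∂μ :=
    f.continuous.integral_pos_of_hasCompactSupport_nonneg_nonzero hfc (fun s => (hf s).1)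
      (x := 1) (by rw [hf1 rfl]; simp)
  have hfi : Integrable f μ := f.continuous.integrable_of_hasCompactSupport hfc
  set I := ∫ s, f s ∂μ with hIdef
  -- The bump function `f` is normalised to have integral $1$. Since it vanishes off `V`, the
  -- average of $F(1)-F(s)$ against it has norm at most $\varepsilon/2$.
  let k : C_c(G, ℂ) :=
    { toFun := fun s => ((I⁻¹ * f s : ℝ) : ℂ)
      continuous_toFun := by fun_prop
      hasCompactSupport' := hfc.comp_left (g := fun t : ℝ => ((I⁻¹ * t : ℝ) : ℂ)) (by simp) }
  have hk : ∀ s, k s = ((I⁻¹ * f s : ℝ) : ℂ) := fun _ => rfl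
  have hk1 : ∫ s, k s ∂μ = 1 := by
    simp_rw [hk]
    rw [integral_complex_ofReal, integral_const_mul, ← hIdef, inv_mul_cancel₀ hI.ne']
    simp
  have hki : Integrable k μ := k.continuous.integrable_of_hasCompactSupport k.hasCompactSupport
  have hkF : Integrable (fun s => k s • F s) μ :=
    (k.continuous.smul hF).integrable_of_hasCompactSupport k.hasCompactSupport.smul_right
  refine ⟨k, ?_⟩
  have e : F 1 - ∫ s, k s • F s ∂μ = ∫ s, k s • (F 1 - F s) ∂μ := by
    simp_rw [smul_sub]
    rw [integral_sub (hki.smul_const _) hkF, integral_smul_const, hk1, one_smul]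
  rw [dist_eq_norm, e]
  refine lt_of_le_of_lt ?_ (half_lt_self hε)
  have hb : ∀ s, ‖k s • (F 1 - F s)‖ ≤ I⁻¹ * f s * (ε / 2) := by
    intro s
    rw [norm_smul, hk, Complex.norm_real, Real.norm_of_nonneg
      (mul_nonneg (inv_nonneg.2 hI.le) (hf s).1)]
    by_cases hs : s ∈ V
    · refine mul_le_mul_of_nonneg_left ?_ (mul_nonneg (inv_nonneg.2 hI.le) (hf s).1)
      rw [← dist_eq_norm, dist_comm]
      exact le_of_lt hs
    · rw [hf0 hs]; simp
  calc ‖∫ s, k s • (F 1 - F s) ∂μ‖ ≤ ∫ s, I⁻¹ * f s * (ε / 2) ∂μ :=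
        norm_integral_le_of_norm_le ((hfi.const_mul _).mul_const _) (Eventually.of_forall hb)
    _ = ε / 2 := by
      rw [integral_mul_const, integral_const_mul, ← hIdef, inv_mul_cancel₀ hI.ne', one_mul]

/-- The representation of `C*(G)` given by a strongly continuous unitary representation. -/
def UnitaryRep.groupCStarRep {H : Type u} [NormedAddCommGroup H] [InnerProductSpace ℂ H]
    [CompleteSpace H] (V : UnitaryRep G H) : UniversalAlgebra G →⋆ₙₐ[ℂ] (H →L[ℂ] H) where
  -- The universal algebra has one coordinate for every representation on a space in `Type u`, so
  -- the integrated form of `V` is evaluation at its coordinate.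
  toFun x := x.1 ⟨H, V⟩
  map_smul' _ _ := rfl
  map_zero' := rfl
  map_add' _ _ := rfl
  map_mul' _ _ := rfl
  map_star' _ := rfl

variable {H : Type u} [NormedAddCommGroup H] [InnerProductSpace ℂ H] [CompleteSpace H]

variable (G) in
/-- The inclusion of `C*(G)` into the universal algebra. -/
def groupCStarInclusion : GroupCStar G →⋆ₙₐ[ℂ] UniversalAlgebra G :=
  NonUnitalStarSubalgebraClass.subtype (groupCStarSubalgebra G)

/-- The image of `f` in `C*(G)`. -/
def groupCStarOf (f : C_c(G, ℂ)) : GroupCStar G :=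
  ⟨universalIntegrated f, NonUnitalStarSubalgebra.le_topologicalClosure _
    (NonUnitalStarAlgebra.subset_adjoin ℂ _ ⟨f, rfl⟩)⟩

/-- Each vector $x=V(1)x$ is a limit of vectors $V(f)x$ with $f\in C_c(G)$. -/
theorem UnitaryRep.isNonDegenerateRep_groupCStarRep (V : UnitaryRep G H) :
    IsNonDegenerateRep (V.groupCStarRep.comp (groupCStarInclusion G)) := by
  intro x
  have h := mem_closure_range_integral (V.continuous_apply x)
  rw [map_one] at h
  refine closure_mono ?_ h
  rintro _ ⟨f, rfl⟩
  exact Submodule.subset_span ⟨groupCStarOf f, x, rfl⟩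

theorem UnitaryRep.repExtension_canonicalHom (V : UnitaryRep G H) (g : G) :
    repExtension _ V.isNonDegenerateRep_groupCStarRep (canonicalHom G g) =
      (V.toHom g : H →L[ℂ] H) :=
  repExtension_eq_of_forall _ fun _ _ => rfl

end Integration

/-! ### Strictly continuous unitary multipliers and their integrals. -/

section MultiplierUnitary

variable {G : Type u} [Group G] [TopologicalSpace G]
  {C : Type*} [NonUnitalCStarAlgebra C] {U : G →* unitary 𝓜(ℂ, C)}

theorem norm_unitary_fst_le (u : unitary 𝓜(ℂ, C)) (c : C) :
    ‖(u : 𝓜(ℂ, C)).fst c‖ ≤ ‖c‖ := by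
  refine ((u : 𝓜(ℂ, C)).fst.le_opNorm c).trans (mul_le_of_le_one_left (norm_nonneg _) ?_)
  rw [DoubleCentralizer.norm_fst]
  -- A unitary has norm one only in a nonzero algebra.
  rcases subsingleton_or_nontrivial 𝓜(ℂ, C) with h | h
  · rw [Subsingleton.elim (u : 𝓜(ℂ, C)) 0, norm_zero]
    exact zero_le_one
  · exact (CStarRing.norm_of_mem_unitary u.2).le

theorem norm_unitary_snd_le (u : unitary 𝓜(ℂ, C)) (c : C) :
    ‖(u : 𝓜(ℂ, C)).snd c‖ ≤ ‖c‖ := by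
  rw [star_snd_star, norm_star, ← norm_star c]
  exact norm_unitary_fst_le (star u) (star c)

/-- The unitary representation on the space of a non-degenerate representation of `C` induced by a
strictly continuous homomorphism into the unitaries of `M(C)`. -/
def inducedRep (hU : StrictlyContinuous fun s => (U s : 𝓜(ℂ, C))) {H : Type*}
    [NormedAddCommGroup H] [InnerProductSpace ℂ H] [CompleteSpace H]
    {π : C →⋆ₙₐ[ℂ] (H →L[ℂ] H)} (hπ : IsNonDegenerateRep π) : UnitaryRep G H where
  toHom :=
    { toFun := fun g => ⟨repExtension π hπ (U g), Unitary.map_mem (repExtension π hπ) (U g).2⟩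
      map_one' := Subtype.ext (by simp)
      map_mul' := fun g h => Subtype.ext (by simp) }
  continuous_apply x := by
    change Continuous fun g => repExtension π hπ (U g : 𝓜(ℂ, C)) x
    have hspan : ∀ z ∈ Submodule.span ℂ {y : H | ∃ (c : C) (x : H), π c x = y},
        Continuous fun g => repExtension π hπ (U g : 𝓜(ℂ, C)) z := by
      intro z hz
      induction hz using Submodule.span_induction with
      | mem z hz =>
        obtain ⟨c, x, rfl⟩ := hz
        simp only [repExtension_apply]
        exact ((continuous_hom π).comp (hU c).1).clm_apply continuous_const
      | zero => simpa using continuous_const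
      | add x y _ _ hx hy => simpa using! hx.add hy
      | smul c x _ hx => simpa using! hx.const_smul c
    -- Unitaries are isometric, so approximating `x` by `z` in the dense span approximates the orbit
    -- map uniformly in `g`.
    refine continuous_of_uniform_approx_of_continuous fun u hu => ?_
    obtain ⟨ε, hε, hεu⟩ := Metric.mem_uniformity_dist.1 hu
    obtain ⟨z, hz, hz'⟩ := Metric.dense_iff.1 hπ x ε hε
    refine ⟨_, hspan z hz', fun g => hεu ?_⟩
    rw [dist_eq_norm, ← map_sub, ContinuousLinearMap.norm_map_of_mem_unitary
      (Unitary.map_mem (repExtension π hπ) (U g).2), ← dist_eq_norm, dist_comm]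
    exact hz

theorem inducedRep_apply (hU : StrictlyContinuous fun s => (U s : 𝓜(ℂ, C))) {H : Type*}
    [NormedAddCommGroup H] [InnerProductSpace ℂ H] [CompleteSpace H]
    {π : C →⋆ₙₐ[ℂ] (H →L[ℂ] H)} (hπ : IsNonDegenerateRep π) (g : G) :
    ((inducedRep hU hπ).toHom g : H →L[ℂ] H) = repExtension π hπ (U g) := rfl

variable [IsTopologicalGroup G] [LocallyCompactSpace G] [MeasurableSpace G] [BorelSpace G]

/-- The continuous operator `c ↦ ∫ f(s) T(s) c ds` for a pointwise continuous family `T` of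
contractions. -/
def integralCLM {T : G → C →L[ℂ] C} (hT : ∀ c, Continuous fun s => T s c)
    (hT1 : ∀ s c, ‖T s c‖ ≤ ‖c‖) (f : C_c(G, ℂ)) : C →L[ℂ] C :=
  have hi : ∀ c, Integrable (fun s => f s • T s c) (Measure.haar : Measure G) := fun c =>
    (f.continuous.smul (hT c)).integrable_of_hasCompactSupport f.hasCompactSupport.smul_right
  LinearMap.mkContinuous
    { toFun := fun c => ∫ s, f s • T s c ∂(Measure.haar : Measure G)
      map_add' := fun x y => by
        simp only [map_add, smul_add]
        exact integral_add (hi x) (hi y)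
      map_smul' := fun c x => by
        simp only [map_smul, RingHom.id_apply]
        rw [← integral_smul]
        exact integral_congr_ae (Eventually.of_forall fun g => smul_comm _ _ _) }
    (∫ s, ‖f s‖ ∂(Measure.haar : Measure G))
    (fun c => by
      rw [← integral_mul_const]
      refine norm_integral_le_of_norm_le ((f.continuous.norm.integrable_of_hasCompactSupport
        f.hasCompactSupport.norm).mul_const _) (Eventually.of_forall fun s => ?_)
      rw [norm_smul]
      exact mul_le_mul_of_nonneg_left (hT1 s c) (norm_nonneg _))

/-- The multiplier `∫ f(s) U(s) ds` of `C`; the integral converges strictly. -/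
def integratedMultiplier (hU : StrictlyContinuous fun s => (U s : 𝓜(ℂ, C))) (f : C_c(G, ℂ)) :
    𝓜(ℂ, C) where
  fst := integralCLM (T := fun s => (U s : 𝓜(ℂ, C)).fst) (fun c => (hU c).1)
    (fun s => norm_unitary_fst_le (U s)) f
  snd := integralCLM (T := fun s => (U s : 𝓜(ℂ, C)).snd) (fun c => (hU c).2)
    (fun s => norm_unitary_snd_le (U s)) f
  central x y := by
    change (∫ s, f s • (U s : 𝓜(ℂ, C)).snd x ∂(Measure.haar : Measure G)) * y =
      x * ∫ s, f s • (U s : 𝓜(ℂ, C)).fst y ∂(Measure.haar : Measure G)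
    have h1 := ((ContinuousLinearMap.mul ℂ C).flip y).integral_comp_comm
      (((f.continuous.smul (hU x).2)).integrable_of_hasCompactSupport
        f.hasCompactSupport.smul_right : Integrable _ (Measure.haar : Measure G))
    have h2 := (ContinuousLinearMap.mul ℂ C x).integral_comp_comm
      (((f.continuous.smul (hU y).1)).integrable_of_hasCompactSupport
        f.hasCompactSupport.smul_right : Integrable _ (Measure.haar : Measure G))
    simp only [ContinuousLinearMap.flip_apply, ContinuousLinearMap.mul_apply'] at h1 h2
    refine h1.symm.trans (Eq.trans ?_ h2)
    refine integral_congr_ae (Eventually.of_forall fun s => ?_)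
    change (f s • (U s : 𝓜(ℂ, C)).snd x) * y = x * (f s • (U s : 𝓜(ℂ, C)).fst y)
    rw [smul_mul_assoc, mul_smul_comm, DoubleCentralizer.central]

theorem integratedMultiplier_fst (hU : StrictlyContinuous fun s => (U s : 𝓜(ℂ, C)))
    (f : C_c(G, ℂ)) (c : C) : (integratedMultiplier hU f).fst c =
      ∫ s, f s • (U s : 𝓜(ℂ, C)).fst c ∂(Measure.haar : Measure G) := rfl

/-- The map $c\mapsto\pi(c)x$ is bounded and so passes under the integral. This places the
integrated operators on $\mathcal H$ in the image of $M(\mathcal C)$. -/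
theorem repExtension_integratedMultiplier (hU : StrictlyContinuous fun s => (U s : 𝓜(ℂ, C)))
    {H : Type*} [NormedAddCommGroup H] [InnerProductSpace ℂ H] [CompleteSpace H]
    {π : C →⋆ₙₐ[ℂ] (H →L[ℂ] H)} (hπ : IsNonDegenerateRep π) (f : C_c(G, ℂ)) :
    repExtension π hπ (integratedMultiplier hU f) = (inducedRep hU hπ).integrated f := by
  refine repExtension_eq_of_forall hπ fun c x => ?_
  let L : C →L[ℂ] H :=
    { toFun := fun c => π c x
      map_add' := fun a b => by simp
      map_smul' := fun a b => by simp
      cont := (continuous_hom π).clm_apply continuous_const }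
  have h := L.integral_comp_comm
      (((f.continuous.smul (hU c).1)).integrable_of_hasCompactSupport
        f.hasCompactSupport.smul_right : Integrable _ (Measure.haar : Measure G))
  rw [UnitaryRep.integrated_apply, integratedMultiplier_fst]
  refine Eq.trans ?_ h
  refine integral_congr_ae (Eventually.of_forall fun s => ?_)
  change f s • repExtension π hπ (U s) (π c x) = L (f s • (U s : 𝓜(ℂ, C)).fst c)
  rw [repExtension_apply, map_smul]
  rfl

theorem mem_closure_range_integratedMultiplier
    (hU : StrictlyContinuous fun s => (U s : 𝓜(ℂ, C))) (c : C) :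
    c ∈ closure (Set.range fun f : C_c(G, ℂ) => (integratedMultiplier hU f).fst c) := by
  have h := mem_closure_range_integral (hU c).1
  beta_reduce at h
  rw [map_one] at h
  exact h

end MultiplierUnitary

/-! ### The embedding of $M(\mathcal C)$ and the construction of $\rho$. -/

section Main

open scoped ComplexOrder

variable {C : Type u} [NonUnitalCStarAlgebra C] [PartialOrder C] [StarOrderedRing C]

/-- Multipliers of `C` are separated by the extensions of the GNS representations of `C`. -/
theorem multiplier_ext_gns {m n : 𝓜(ℂ, C)}
    (h : ∀ f : C →ₚ[ℂ] ℂ, repExtension _ (isNonDegenerateRep_gns f) m =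
      repExtension _ (isNonDegenerateRep_gns f) n) : m = n := by
  refine ext_fst (ContinuousLinearMap.ext fun c => sub_eq_zero.1 ?_)
  by_contra hne
  -- A GNS representation that is nonzero on $mc-nc$ contradicts
  -- $\pi_f(mc)=\widetilde\pi_f(m)\pi_f(c)$.
  obtain ⟨f, hf⟩ := exists_gns_ne_zero hne
  refine hf (ContinuousLinearMap.ext fun x => ?_)
  rw [map_sub, sub_apply,
    ← repExtension_apply _ (isNonDegenerateRep_gns f), h f, repExtension_apply, sub_self,
    zero_apply]

variable (C) in
/-- The embedding of `M(C)` into the bounded product of the operators on all GNS spaces. -/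
def universalMultiplierHom :
    𝓜(ℂ, C) →⋆ₙₐ[ℂ] BoundedProduct fun f : C →ₚ[ℂ] ℂ => f.GNS →L[ℂ] f.GNS :=
  boundedProductHom fun f => repExtensionHom _ (isNonDegenerateRep_gns f)

theorem universalMultiplierHom_eq_iff {D : Type*} [NonUnitalCStarAlgebra D]
    {r : ∀ f : C →ₚ[ℂ] ℂ, D →⋆ₙₐ[ℂ] (f.GNS →L[ℂ] f.GNS)} {m : 𝓜(ℂ, C)} {d : D} :
    universalMultiplierHom C m = boundedProductHom r d ↔
      ∀ f : C →ₚ[ℂ] ℂ, repExtension _ (isNonDegenerateRep_gns f) m = r f d :=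
  boundedProductHom_eq_iff

theorem universalMultiplierHom_injective : Function.Injective (universalMultiplierHom C) :=
  fun _ _ h => multiplier_ext_gns (universalMultiplierHom_eq_iff.1 h)

variable {G : Type u} [Group G] [TopologicalSpace G] [IsTopologicalGroup G]
  [LocallyCompactSpace G] [MeasurableSpace G] [BorelSpace G] {U : G →* unitary 𝓜(ℂ, C)}

/-- The operators by which `C*(G)` acts on the GNS spaces of `C` come from multipliers of `C`. -/
theorem exists_multiplier_groupCStarRep (hU : StrictlyContinuous fun s => (U s : 𝓜(ℂ, C)))
    (l : GroupCStar G) : ∃ m : 𝓜(ℂ, C), ∀ f : C →ₚ[ℂ] ℂ,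
      repExtension _ (isNonDegenerateRep_gns f) m =
        (inducedRep hU (isNonDegenerateRep_gns f)).groupCStarRep l := by
  obtain ⟨m, hm⟩ := exists_eq_of_mem_closure_adjoin (universalMultiplierHom_injective (C := C))
    (boundedProductHom fun f => (inducedRep hU (isNonDegenerateRep_gns f)).groupCStarRep)
    (S := Set.range (universalIntegrated (G := G))) (by
      rintro _ ⟨k, rfl⟩
      exact ⟨integratedMultiplier hU k, universalMultiplierHom_eq_iff.2 fun f =>
        repExtension_integratedMultiplier hU (isNonDegenerateRep_gns f) k⟩) l.2
  exact ⟨m, universalMultiplierHom_eq_iff.1 hm⟩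

variable {A : Type u} [NonUnitalCStarAlgebra A] {B : Type v} [NonUnitalCStarAlgebra B]
  {α : G →* (A ≃⋆ₐ[ℂ] A)} {ηA : A →⋆ₙₐ[ℂ] 𝓜(ℂ, B)} {ηL : GroupCStar G →⋆ₙₐ[ℂ] 𝓜(ℂ, B)}
  {φ : A →⋆ₙₐ[ℂ] 𝓜(ℂ, C)}

/-- The homomorphism `B → M(C)` induced by a covariant pair of homomorphisms into `M(C)`. -/
theorem IsFullCrossedProductHost.exists_hom (hB : IsFullCrossedProductHost α ηA ηL)
    (hφ : IsNonDegenerate φ) (hU : StrictlyContinuous fun s => (U s : 𝓜(ℂ, C)))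
    (hcov : ∀ (a : A) (s : G), φ (α s a) = (U s : 𝓜(ℂ, C)) * φ a * star (U s : 𝓜(ℂ, C))) :
    ∃ ρ : B →⋆ₙₐ[ℂ] 𝓜(ℂ, C), ∀ (f : C →ₚ[ℂ] ℂ) (a : A) (l : GroupCStar G) (b : B),
      (b : 𝓜(ℂ, B)) = ηA a * ηL l →
      repExtension _ (isNonDegenerateRep_gns f) (ρ b) =
        repExtension _ (isNonDegenerateRep_gns f) (φ a) *
          (inducedRep hU (isNonDegenerateRep_gns f)).groupCStarRep l := by
  -- The universal property is applied on each GNS space, which lies in `Type u` because `C` does.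
  have hex : ∀ f : C →ₚ[ℂ] ℂ, ∃ ρ : B →⋆ₙₐ[ℂ] (f.GNS →L[ℂ] f.GNS),
      ∀ (a : A) (l : GroupCStar G) (b : B), (b : 𝓜(ℂ, B)) = ηA a * ηL l →
        ρ b = repExtension _ (isNonDegenerateRep_gns f) (φ a) *
          (inducedRep hU (isNonDegenerateRep_gns f)).groupCStarRep l := fun f =>
    (hB.existsUnique_rep f.GNS ((repExtensionHom _ (isNonDegenerateRep_gns f)).comp φ)
      (inducedRep hU (isNonDegenerateRep_gns f)) _
      (inducedRep hU (isNonDegenerateRep_gns f)).isNonDegenerateRep_groupCStarRep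
      (isNonDegenerateRep_comp _ hφ)
      (fun g a => by
        rw [inducedRep_apply, ← map_star, NonUnitalStarAlgHom.comp_apply,
          NonUnitalStarAlgHom.comp_apply, repExtensionHom_apply, repExtensionHom_apply,
          ← map_mul, ← map_mul, hcov])
      (UnitaryRep.repExtension_canonicalHom _)).exists
  choose r hr using hex
  -- It suffices to lift the generators, and $\eta_{\mathcal A}(a)\eta_{\mathcal L}(l)$ lifts to
  -- $\phi(a)m_l$.
  have hlift : ∀ b : B, ∃ m, universalMultiplierHom C m = boundedProductHom r b := fun b =>
    exists_eq_of_mem_closure_adjoin (universalMultiplierHom_injective (C := C))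
      (boundedProductHom r) (by
        rintro b ⟨a, l, hb⟩
        obtain ⟨m, hm⟩ := exists_multiplier_groupCStarRep hU l
        refine ⟨φ a * m, universalMultiplierHom_eq_iff.2 fun f => ?_⟩
        rw [map_mul, hm, hr f a l b hb])
      (hB.generates ▸ NonUnitalStarAlgebra.mem_top)
  obtain ⟨ρ, hρ⟩ := exists_hom_comp_eq (universalMultiplierHom_injective (C := C)) _ hlift
  exact ⟨ρ, fun f a l b hb => (universalMultiplierHom_eq_iff.1 (hρ b) f).trans (hr f a l b hb)⟩

theorem IsFullCrossedProductHost.exists_nonDegenerate_hom (hB : IsFullCrossedProductHost α ηA ηL)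
    (hφ : IsNonDegenerate φ) (hU : StrictlyContinuous fun s => (U s : 𝓜(ℂ, C)))
    (hcov : ∀ (a : A) (s : G), φ (α s a) = (U s : 𝓜(ℂ, C)) * φ a * star (U s : 𝓜(ℂ, C))) :
    ∃ (ρ : B →⋆ₙₐ[ℂ] 𝓜(ℂ, C)) (hρ : IsNonDegenerate ρ),
      (∀ a : A, multiplierExtension ρ hρ (ηA a) = φ a) ∧
      (∀ s : G, multiplierExtension ρ hρ
        (multiplierExtension ηL hB.nonDegenerate (canonicalHom G s)) = U s) := by
  obtain ⟨ρ, hgen⟩ := hB.exists_hom hφ hU hcov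
  let S : Set B := {b | ∃ (a : A) (l : GroupCStar G), (b : 𝓜(ℂ, B)) = ηA a * ηL l}
  have hint : ∀ (a : A) (k : C_c(G, ℂ)) (b : B), (b : 𝓜(ℂ, B)) = ηA a * ηL (groupCStarOf k) →
      ρ b = φ a * integratedMultiplier hU k := fun a k b hb =>
    multiplier_ext_gns fun f => by
      rw [hgen f a _ b hb, map_mul, repExtension_integratedMultiplier]
      rfl
  have hd : Dense (Submodule.span ℂ {y : C | ∃ b ∈ S, ∃ x : C, (ρ b).fst x = y} : Set C) := by
    let K : Submodule ℂ C := Submodule.span ℂ {y : C | ∃ b ∈ S, ∃ x : C, (ρ b).fst x = y}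
    have hK : (Submodule.span ℂ {y : C | ∃ (a : A) (x : C), (φ a).fst x = y}) ≤
        K.topologicalClosure := by
      rw [Submodule.span_le]
      rintro _ ⟨a, x, rfl⟩
      -- $\phi(a)x$ is a limit of $\phi(a)\int k(s)U(s)x\,ds=\rho(b)x$ with $b=\eta_{\mathcal
      -- A}(a)\eta_{\mathcal L}(k)$.
      refine map_mem_closure (φ a).fst.continuous
        (mem_closure_range_integratedMultiplier hU x) ?_
      rintro _ ⟨k, rfl⟩
      obtain ⟨b, hb⟩ := hB.mul_mem a (groupCStarOf k)
      refine Submodule.subset_span ⟨b, ⟨a, _, hb⟩, x, ?_⟩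
      rw [hint a k b hb]
      rfl
    exact fun x => closure_minimal hK isClosed_closure (hφ.dense x)
  have hρ : IsNonDegenerate ρ := by
    refine isNonDegenerate_of_dense (hd.mono (Submodule.span_mono ?_))
    rintro _ ⟨b, -, x, rfl⟩
    exact ⟨b, x, rfl⟩
  refine ⟨ρ, hρ, fun a => multiplierExtension_eq_of_forall hρ hd ?_,
    fun s => multiplierExtension_eq_of_forall hρ hd ?_⟩
  -- Left multiplication by $\eta_{\mathcal A}(a)$ turns the generator for $(a',l)$ into the one for
  -- $(aa',l)$.
  · rintro b ⟨a', l, hb⟩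
    refine multiplier_ext_gns fun f => ?_
    rw [hgen f (a * a') l _ (by rw [← mul_coe, hb, map_mul, mul_assoc]), map_mul, map_mul,
      map_mul, hgen f a' l b hb, mul_assoc]
  · rintro b ⟨a, l, hb⟩
    set V := multiplierExtension ηL hB.nonDegenerate (canonicalHom G s) with hV
    have hVV : star V * V = 1 := by
      rw [hV, ← map_star, ← map_mul, Unitary.coe_star_mul_self, map_one]
    have hVl : V * ηL l = ηL ((canonicalHom G s : 𝓜(ℂ, GroupCStar G)).fst l) := by
      rw [hV, ← multiplierExtension_coe ηL hB.nonDegenerate, ← map_mul, mul_coe,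
        multiplierExtension_coe]
    -- By covariance, `V` carries the generator for $(a,l)$ to the one for $(\alpha_s(a),\eta(s)l)$.
    -- Its image is $U(s)\phi(a)U(s)^*\,U(s)m_l=U(s)\rho(b)$.
    have hb' : ((V.fst b : B) : 𝓜(ℂ, B)) =
        ηA (α s a) * ηL ((canonicalHom G s : 𝓜(ℂ, GroupCStar G)).fst l) := by
      rw [← mul_coe, hb, ← hVl, ← hB.covariant a s, ← hV, mul_assoc, mul_assoc,
        ← mul_assoc (star V), hVV, one_mul]
    refine multiplier_ext_gns fun f => ?_
    have hUL : (inducedRep hU (isNonDegenerateRep_gns f)).groupCStarRep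
        ((canonicalHom G s : 𝓜(ℂ, GroupCStar G)).fst l : GroupCStar G) =
        repExtension _ (isNonDegenerateRep_gns f) (U s) *
          (inducedRep hU (isNonDegenerateRep_gns f)).groupCStarRep l := rfl
    rw [hgen f _ _ _ hb', map_mul, hgen f a l b hb, hUL, hcov, map_mul, map_mul]
    have hUU : repExtension _ (isNonDegenerateRep_gns f) (star (U s : 𝓜(ℂ, C))) *
        repExtension _ (isNonDegenerateRep_gns f) (U s) = 1 := by
      rw [← map_mul, Unitary.coe_star_mul_self, map_one]
    rw [mul_assoc, ← mul_assoc (repExtension _ _ (star _)), hUU, one_mul, mul_assoc]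

end Main

end CPHost

end

theorem mainTheorem7
    {G : Type u} [CommGroup G] [TopologicalSpace G] [IsTopologicalGroup G]
    [LocallyCompactSpace G] [T2Space G] [MeasurableSpace G] [BorelSpace G]
    {A : Type u} [NonUnitalCStarAlgebra A] (α : G →* (A ≃⋆ₐ[ℂ] A))
    -- a full crossed product host `(B, η_A, η_L)`
    {B : Type v} [NonUnitalCStarAlgebra B]
    (ηA : A →⋆ₙₐ[ℂ] 𝓜(ℂ, B)) (ηL : CPHost.GroupCStar G →⋆ₙₐ[ℂ] 𝓜(ℂ, B))
    (hB : CPHost.IsFullCrossedProductHost α ηA ηL)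
    {C : Type u} [NonUnitalCStarAlgebra C]
    (φ : A →⋆ₙₐ[ℂ] 𝓜(ℂ, C)) (hφ : CPHost.IsNonDegenerate φ)
    (U : G →* unitary 𝓜(ℂ, C)) (hU : CPHost.StrictlyContinuous fun s => (U s : 𝓜(ℂ, C)))
    (hcov : ∀ (a : A) (s : G), φ (α s a) = (U s : 𝓜(ℂ, C)) * φ a * star (U s : 𝓜(ℂ, C))) :
    ∃ (ρ : B →⋆ₙₐ[ℂ] 𝓜(ℂ, C)) (hρ : CPHost.IsNonDegenerate ρ),
      (∀ a : A, CPHost.multiplierExtension ρ hρ (ηA a) = φ a) ∧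
      (∀ s : G, CPHost.multiplierExtension ρ hρ
        (CPHost.multiplierExtension ηL hB.nonDegenerate (CPHost.canonicalHom G s)) = U s) := by
  -- Positive functionals need an order on `C`; the spectral order is the canonical choice.
  let _ := CStarAlgebra.spectralOrder C
  let _ := CStarAlgebra.spectralOrderedRing C
  exact hB.exists_nonDegenerate_hom hφ hU hcov
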